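/- **Conventions.** Let $\mathbb K=\mathbb R$ or $\mathbb C$, let $n\ge 1$, and give $M_n(\mathbb K)$ the operator norm for the Euclidean norm on $\mathbb K^n$. For a matrix-valued function $f$ on a metric space $(Z,\rho)$ put $L^{\rho}(f)=\sup\{\|f(x)-f(y)\|/\rho(x,y): x\neq y\}\in[0,\infty]$. For a compact metric space $X$ let $\mathcal P_n(X)$ be the set of functions $p:X\to M_n(\mathbb K)$ with $p(x)^2=p(x)=p(x)^*$ for all $x$ and $L(p)<\infty$, and for $r>0$ let $\mathcal P_n^r(X)=\{p\in\mathcal P_n(X): L(p)<r\}$. Both carry the topology of the supremum norm, and paths are continuous functions on $[0,1]$. A $q\in\mathcal P_n(Y)$ determines the vector bundle over $Y$ with fibre $q(y)\mathbb K^n$ at $y$ and total space $\{(y,v): v\in q(y)\mathbb K^n\}\subseteq Y\times\mathbb K^n$. Let $\lambda_n$ be the smallest constant (the infimum of the constants) $c\ge 0$ with the following property: for every compact metric space $Z$, every closed $X\subseteq Z$, every compact space $T$, every continuous $F$ from $X\times T$ to the self-adjoint matrices in $M_n(\mathbb C)$, and every $N\ge 0$ such that $L(F(\cdot,t))\le N$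 for all $t\in T$, there is a continuous extension $G$ of $F$ to $Z\times T$ with self-adjoint values, with $L(G(\cdot,t))\le cN$ for all $t$, and with $\|G\|_\infty=\|F\|_\infty$. (The same $\lambda_n$, defined over $\mathbb C$, is used for $\mathbb K=\mathbb R$.) **Theorem 6.5.** Let $X$ and $Y$ be compact metric spaces and let $\rho$ be a metric on the disjoint union $X\sqcup Y$ that restricts to the given metrics on $X$ and $Y$. Let $r>0$ and let $\varepsilon$ be such that $\varepsilon\lambda_n r<1/14$ and the Hausdorff distance of $X$ and $Y$ for $\rho$ is less than $\varepsilon$. Put $s=\lambda_n r(1-12\varepsilon\lambda_n r)^{-1}$. Then $\varepsilon s<1/2$. Let $p_0,p_1$ lie in the same path component of $\mathcal P_n^r(X)$, and for functions $p$ on $X$ and $q$ on $Y$ let $p\oplus q$ be the function on $X\sqcup Y$ that is $p$ on $X$ and $q$ on $Y$. 1. There are $q_0,q_1\in\mathcal P_n^s(Y)$ with $L^\rho(p_j\oplus q_j)<s$ for $j=0,1$. 2. For any such $q_0,q_1$ and any $\delta$ with $2\varepsilon s<\delta<1$ there are a path $t\mapsto p_t$ in $\mathcal P_n(X)$ from $p_0$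 to $p_1$ and a path $t\mapsto q_t$ in $\mathcal P_n(Y)$ from $q_0$ to $q_1$ such that $L^\rho(p_t\oplus q_t)<(1-\delta)^{-1}s$ for all $t\in[0,1]$. 3. For any such $q_0,q_1$, the vector bundles over $Y$ determined by $q_0$ and $q_1$ are isomorphic. -/

import Mathlib

open scoped NNReal ENNReal Matrix.Norms.L2Operator

namespace ProjBundle

/-- The Lipschitz seminorm `L(f) = sup { ‖f x - f y‖ / ρ(x, y) : x ≠ y }`, with values in
`[0, ∞]`, of a function on a metric space. On matrices, `‖·‖` is the operator norm for the
Euclidean norm of `𝕜ⁿ`. -/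
noncomputable def lip {Z E : Type*} [MetricSpace Z] [NormedAddCommGroup E] (f : Z → E) : ℝ≥0∞ :=
  ⨆ (x : Z) (y : Z) (_ : x ≠ y), ENNReal.ofReal (‖f x - f y‖ / dist x y)

/-- `c` is an admissible constant for the simultaneous extension of Lipschitz families with values
in the self-adjoint complex `n × n` matrices: for every compact metric space `Z`, every closed
`X ⊆ Z`, every compact parameter space `T`, and every continuous `F` on `X × T` with `L(F_t) ≤ N`
for all `t`, there is a continuous extension `G` of `F` to `Z × T` with `L(G_t) ≤ c N` for all `t`
and with the same supremum norm as `F`.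

It is no restriction that `Z` and `T` live in `Type`: a compact metric space is isometric to one
in `Type`, and `F` factors through the image of `T` in the metric space of continuous functions
on `X`, so that `T` may be replaced by that image. -/
def IsExtensionConst (n : ℕ) (c : ℝ≥0) : Prop :=
  ∀ (Z T : Type) [MetricSpace Z] [CompactSpace Z] [TopologicalSpace T] [CompactSpace T]
    (X : Set Z), IsClosed X →
    ∀ (F : C(X × T, selfAdjoint (Matrix (Fin n) (Fin n) ℂ))) (N : ℝ≥0),
      (∀ t : T, lip (fun x : X => F (x, t)) ≤ N) →
      ∃ G : C(Z × T, selfAdjoint (Matrix (Fin n) (Fin n) ℂ)),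
        (∀ (x : X) (t : T), G ((x : Z), t) = F (x, t)) ∧
        (∀ t : T, lip (fun z : Z => G (z, t)) ≤ c * N) ∧
        (⨆ w : Z × T, ‖G w‖ₑ) = ⨆ w : X × T, ‖F w‖ₑ

/-- The constant `λ_n`: the infimum of the admissible extension constants. -/
noncomputable def extensionConst (n : ℕ) : ℝ≥0 :=
  sInf {c : ℝ≥0 | IsExtensionConst n c}

/-- `𝒫_n(X)`: the Lipschitz functions on `X` whose values are self-adjoint idempotent `n × n`
matrices. It is a subset of `C(X, M_n(𝕜))`, which for compact `X` carries the topology of the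
supremum norm. -/
def projections (𝕜 : Type*) [RCLike 𝕜] (n : ℕ) (X : Type*) [MetricSpace X] :
    Set C(X, Matrix (Fin n) (Fin n) 𝕜) :=
  {p | (∀ x, IsStarProjection (p x)) ∧ lip p < ⊤}

/-- `𝒫_n^r(X)`: the elements `p` of `𝒫_n(X)` with `L(p) < r`. -/
def projectionsLT (𝕜 : Type*) [RCLike 𝕜] (n : ℕ) (X : Type*) [MetricSpace X] (r : ℝ) :
    Set C(X, Matrix (Fin n) (Fin n) 𝕜) :=
  {p | p ∈ projections 𝕜 n X ∧ lip p < ENNReal.ofReal r}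

/-- `L^ρ(p ⊕ q)`, where `p ⊕ q` is the function on the disjoint union of `X` and `Y` that is `p`
on `X` and `q` on `Y`, and `ρ` is the given metric on the disjoint union. -/
noncomputable def lipSum {𝕜 : Type*} [RCLike 𝕜] {n : ℕ} {X Y : Type*}
    [MetricSpace X] [MetricSpace Y] [MetricSpace (X ⊕ Y)]
    (p : C(X, Matrix (Fin n) (Fin n) 𝕜)) (q : C(Y, Matrix (Fin n) (Fin n) 𝕜)) : ℝ≥0∞ :=
  lip (Sum.elim p q : X ⊕ Y → Matrix (Fin n) (Fin n) 𝕜)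

/-- The fibre at `y` of the vector bundle determined by `q`: the subspace `q_y(𝕜ⁿ)` of `𝕜ⁿ`. -/
def fiber {𝕜 : Type*} [RCLike 𝕜] {n : ℕ} {Y : Type*} [TopologicalSpace Y]
    (q : C(Y, Matrix (Fin n) (Fin n) 𝕜)) (y : Y) : Submodule 𝕜 (Fin n → 𝕜) :=
  LinearMap.range (Matrix.mulVecLin (q y))

/-- The total space of the vector bundle determined by `q`, a subspace of `Y × 𝕜ⁿ`. -/
abbrev TotalSpace {𝕜 : Type*} [RCLike 𝕜] {n : ℕ} {Y : Type*} [TopologicalSpace Y]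
    (q : C(Y, Matrix (Fin n) (Fin n) 𝕜)) : Type _ :=
  {w : Y × (Fin n → 𝕜) // w.2 ∈ fiber q w.1}

/-- The vector bundles on `Y` determined by `q₀` and `q₁` are isomorphic: there is a homeomorphism
of the total spaces that covers the identity of `Y` and is a linear isomorphism on each fibre. -/
def BundleIsomorphic {𝕜 : Type*} [RCLike 𝕜] {n : ℕ} {Y : Type*} [TopologicalSpace Y]
    (q₀ q₁ : C(Y, Matrix (Fin n) (Fin n) 𝕜)) : Prop :=
  ∃ (Φ : TotalSpace q₀ ≃ₜ TotalSpace q₁) (φ : ∀ y : Y, fiber q₀ y ≃ₗ[𝕜] fiber q₁ y),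
    ∀ (y : Y) (v : fiber q₀ y),
      Φ ⟨(y, (v : Fin n → 𝕜)), v.2⟩ = ⟨(y, (φ y v : Fin n → 𝕜)), (φ y v).2⟩

end ProjBundle

/-!
A self-adjoint matrix `A` within `η < 1/2` of a projection has no spectrum in `(η, 1 - η)`, so its
spectral projection `χ(A)` for `[1/2, ∞)` is defined by a clean cut. On such matrices `χ` is
Lipschitz with constant `(1 - 2η)⁻¹` (`lipschitzOnWith_specProj`): with `P = χ(A)` and `Q = χ(B)`,
the block `X = P (1 - Q)` solves the Sylvester equation `A X - X B = P (A - B) (1 - Q)`, whose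
coefficients have spectra separated by `1 - 2η`, and `‖P - Q‖` is the larger of the norms of the two
off-diagonal blocks.

A path `p_t` in `𝒫_n^r(X)` is a family parametrized by `[0, 1]`, so for every admissible extension
constant `c` it extends to a family `G_t` of self-adjoint functions on `X ⊔ Y` with `L(G_t) ≤ c r`.
Every point of `Y` being within `ε` of `X`, the values of `G_t` are within `ε c r` of projections,
and `χ(G_t)` is a path of projections on `X ⊔ Y` that extends `p_t` and has
`L ≤ c r (1 - 2 ε c r)⁻¹`. If `c` is close enough to `λ_n` this is less than `s`, because of the
slack between the factors `2` and `12`. The endpoints give the first claim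
(`IsExtensionConst.exists_joinedIn_projectionPairs`). Given other functions `q_0`, `q_1` as in the
second claim, each `q_j` is joined to the corresponding endpoint by the spectral projections of the
segment between them, while `p_j` stays fixed; this costs the factor `(1 - 2 ε s)⁻¹`
(`joinedIn_projectionPairs_of_lipSum_lt`). Finally, a path of projections in the Banach algebra
`C(Y, M_n(𝕜))` has similar endpoints (`exists_unit_mul_eq_of_path`), and the similarity is an
isomorphism of the bundles.

Two facts about `λ_n` enter. Admissible constants exist (`exists_isExtensionConst`): extend
coordinates by the McShane formula, which depends continuously on the function, and retract radially
onto a ball. And `λ_n ≥ 1` (`one_le_extensionConst`), so that `s > 0`. For `𝕜` other than `ℂ`, a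
family of matrices over `𝕜` is extended as a complex family and mapped back by taking real parts
entrywise when `𝕜` is real. Spaces in an arbitrary universe are replaced by their images in `ℓ^∞`.
-/

namespace ProjBundle

/-! ### Spectral projections of almost idempotent self-adjoint matrices -/

section SpectralProjection

/-- The real normed algebra structure underlying the operator norm on matrices over `𝕜`. It extends
the existing real algebra structure, so that it can be used together with the real continuous
functional calculus of Hermitian matrices. -/
noncomputable instance matrixNormedAlgebraReal {𝕜 : Type*} [RCLike 𝕜] {n : ℕ} :
    NormedAlgebra ℝ (Matrix (Fin n) (Fin n) 𝕜) where
  norm_smul_le r A := by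
    rw [← algebraMap_smul 𝕜 r A]
    refine (norm_smul_le _ _).trans ?_
    simp

variable {𝕜 : Type*} [RCLike 𝕜] {n : ℕ}

lemma continuousOn_spectrum (f : ℝ → ℝ) (A : Matrix (Fin n) (Fin n) 𝕜) :
    ContinuousOn f (spectrum ℝ A) :=
  A.finite_real_spectrum.continuousOn f

lemma norm_one_matrix_le : ‖(1 : Matrix (Fin n) (Fin n) 𝕜)‖ ≤ 1 :=
  (IsStarProjection.one (R := Matrix (Fin n) (Fin n) 𝕜)).norm_le

/-- The spectral projection of a self-adjoint matrix for the spectral subset `[1/2, ∞)`. -/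
noncomputable def specProj (A : Matrix (Fin n) (Fin n) 𝕜) : Matrix (Fin n) (Fin n) 𝕜 :=
  cfc (fun x : ℝ => if 1 / 2 ≤ x then 1 else 0) A

lemma isStarProjection_specProj (A : Matrix (Fin n) (Fin n) 𝕜) :
    IsStarProjection (specProj A) := by
  refine ⟨?_, cfc_predicate _ _⟩
  unfold IsIdempotentElem specProj
  rw [← cfc_mul _ _ A (continuousOn_spectrum _ _) (continuousOn_spectrum _ _)]
  congr 1
  ext x
  split_ifs <;> simp

lemma specProj_eq_self {P : Matrix (Fin n) (Fin n) 𝕜} (hP : IsStarProjection P) :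
    specProj P = P := by
  have h : (spectrum ℝ P).EqOn (fun x : ℝ => if 1 / 2 ≤ x then 1 else 0) (fun x => x) := by
    intro x hx
    rcases hP.isIdempotentElem.spectrum_subset ℝ hx with h | h
    · rw [h]; norm_num
    · rw [Set.mem_singleton_iff.mp h]; norm_num
  rw [specProj, cfc_congr h, cfc_id' ℝ P hP.isSelfAdjoint]

lemma norm_two_mul_sub_one_le {P : Matrix (Fin n) (Fin n) 𝕜} (hP : IsStarProjection P) :
    ‖2 * P - 1‖ ≤ 1 := by
  have h1 : star (2 * P - 1) * (2 * P - 1) = 1 := by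
    have h2 : star (2 * P - 1) = 2 * P - 1 := by
      simp [hP.isSelfAdjoint.star_eq, two_mul]
    have := hP.isIdempotentElem.eq
    rw [h2]
    linear_combination (norm := noncomm_ring) 4 • this
  have h3 := CStarRing.norm_star_mul_self (x := 2 * P - 1)
  rw [h1] at h3
  nlinarith [norm_nonneg (2 * P - 1), norm_one_matrix_le (𝕜 := 𝕜) (n := n)]

/-- The spectrum of a matrix close to a projection avoids a neighbourhood of `1/2`. -/
lemma le_abs_sub_half_of_mem_spectrum {A P : Matrix (Fin n) (Fin n) 𝕜} (hP : IsStarProjection P)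
    {η : ℝ} (h : ‖A - P‖ ≤ η) {x : ℝ} (hx : x ∈ spectrum ℝ A) : 1 / 2 - η ≤ |x - 1 / 2| := by
  by_contra! hlt
  refine spectrum.mem_iff.mp hx ?_
  set W := 2 * P - 1 with hW
  have hWW : W * W = 1 := by
    have := hP.isIdempotentElem.eq
    rw [hW]
    linear_combination (norm := noncomm_ring) 4 • this
  set D := (x - 1 / 2) • (1 : Matrix (Fin n) (Fin n) 𝕜) - (A - P) with hD
  have hDn : ‖D‖ < 1 / 2 := by
    have h1 := norm_one_matrix_le (𝕜 := 𝕜) (n := n)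
    calc ‖D‖ ≤ ‖(x - 1 / 2) • (1 : Matrix (Fin n) (Fin n) 𝕜)‖ + ‖A - P‖ := norm_sub_le _ _
      _ ≤ |x - 1 / 2| * 1 + η := by
        rw [norm_smul, Real.norm_eq_abs]; gcongr
      _ < 1 / 2 := by linarith
  have hu : IsUnit (1 - (2 : ℝ) • (W * D)) := by
    refine isUnit_one_sub_of_norm_lt_one ?_
    rw [norm_smul, Real.norm_eq_abs, abs_two]
    have := norm_mul_le W D
    have hw : ‖W‖ ≤ 1 := norm_two_mul_sub_one_le hP
    nlinarith [norm_nonneg D]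
  have hWu : IsUnit W := ⟨⟨W, W, hWW, hWW⟩, rfl⟩
  have key : algebraMap ℝ (Matrix (Fin n) (Fin n) 𝕜) x - A
      = (-(1 / 2 : ℝ)) • (W * (1 - (2 : ℝ) • (W * D))) := by
    rw [mul_sub, mul_smul_comm, ← mul_assoc, hWW, one_mul, mul_one, smul_sub, smul_smul, hD, hW,
      Algebra.algebraMap_eq_smul_one, two_mul]
    module
  rw [key]
  have h2 := (hWu.mul hu)
  rw [show (-(1 / 2 : ℝ)) • (W * (1 - (2 : ℝ) • (W * D)))
    = (Units.mk0 (-(1 / 2 : ℝ)) (by norm_num)) • (W * (1 - (2 : ℝ) • (W * D))) from rfl]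
  exact h2.smul _

/-- For orthogonal projections `P` and `Q`, the operator `P - Q` maps the orthogonal decomposition
`range (1 - Q) ⊕ range Q` to `range P ⊕ range (1 - P)`, so its norm is at most the larger of the
norms of the two blocks. -/
lemma norm_sub_le_of_blocks {P Q : Matrix (Fin n) (Fin n) 𝕜} (hP : IsStarProjection P)
    (hQ : IsStarProjection Q) {m : ℝ} (hm : 0 ≤ m) (h1 : ‖P * (1 - Q)‖ ≤ m)
    (h2 : ‖(1 - P) * Q‖ ≤ m) : ‖P - Q‖ ≤ m := by
  set Φ := Matrix.toEuclideanCLM (n := Fin n) (𝕜 := 𝕜)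
  have pyth : ∀ {R : Matrix (Fin n) (Fin n) 𝕜}, IsStarProjection R →
      ∀ v w, ‖Φ R v + Φ (1 - R) w‖ ^ 2 = ‖Φ R v‖ ^ 2 + ‖Φ (1 - R) w‖ ^ 2 := by
    intro R hR v w
    have h0 : inner 𝕜 (Φ R v) (Φ (1 - R) w) = 0 := by
      rw [← ContinuousLinearMap.adjoint_inner_right, ← ContinuousLinearMap.star_eq_adjoint,
        ← map_star, hR.isSelfAdjoint.star_eq, ← mul_apply_eq_comp, ← map_mul, mul_sub,
        hR.isIdempotentElem.eq]
      simp
    simpa [sq] using norm_add_sq_eq_norm_sq_add_norm_sq_of_inner_eq_zero _ _ h0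
  rw [Matrix.cstar_norm_def]
  refine ContinuousLinearMap.opNorm_le_bound _ hm fun v => ?_
  have hQ1 := hQ.isIdempotentElem.eq
  have e1 : Φ (P - Q) v = Φ P (Φ (1 - Q) v) + Φ (1 - P) (-(Φ Q v)) := by
    have : P - Q = P * (1 - Q) - (1 - P) * Q := by noncomm_ring
    rw [this, map_sub, map_mul, map_mul, map_neg, ← sub_eq_add_neg]
    rfl
  have b1 : ‖Φ P (Φ (1 - Q) v)‖ ≤ m * ‖Φ (1 - Q) v‖ := by
    have : Φ P (Φ (1 - Q) v) = Φ (P * (1 - Q)) (Φ (1 - Q) v) := by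
      have h : (1 - Q) * (1 - Q) = 1 - Q := by
        linear_combination (norm := noncomm_ring) hQ1
      rw [← mul_apply_eq_comp, ← mul_apply_eq_comp, ← map_mul, ← map_mul, mul_assoc, h]
    rw [this]
    exact ContinuousLinearMap.le_of_opNorm_le _ h1 _
  have b2 : ‖Φ (1 - P) (-(Φ Q v))‖ ≤ m * ‖Φ Q v‖ := by
    have : Φ (1 - P) (Φ Q v) = Φ ((1 - P) * Q) (Φ Q v) := by
      rw [← mul_apply_eq_comp, ← mul_apply_eq_comp, ← map_mul, ← map_mul, mul_assoc, hQ1]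
    rw [map_neg, norm_neg, this]
    exact ContinuousLinearMap.le_of_opNorm_le _ h2 _
  have e2 := pyth hP (Φ (1 - Q) v) (-(Φ Q v))
  have e3 := pyth hQ v v
  have e4 : Φ Q v + Φ (1 - Q) v = v := by
    rw [← add_apply, ← map_add]
    simp
  rw [e4] at e3
  rw [← e1] at e2
  have c1 := pow_le_pow_left₀ (norm_nonneg _) b1 2
  have c2 := pow_le_pow_left₀ (norm_nonneg _) b2 2
  refine le_of_sq_le_sq ?_ (by positivity)
  change ‖Φ (P - Q) v‖ ^ 2 ≤ _
  rw [e2, mul_pow, e3]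
  linarith

/-- If the spectra of `A` and `B` keep distance `g` from `1/2`, then the off-diagonal block of
`A - B` between the upper spectral subspace of `A` and the lower one of `B` controls
`P (1 - Q)`, where `P` and `Q` are the spectral projections: `X = P (1 - Q)` solves the Sylvester
equation `A X - X B = P (A - B) (1 - Q)`, whose coefficients are separated by a gap of `2 g`. -/
lemma norm_specProj_mul_one_sub_le {A B : Matrix (Fin n) (Fin n) 𝕜} (hA : IsSelfAdjoint A)
    (hB : IsSelfAdjoint B) {g : ℝ} (hg : 0 < g) (hAg : ∀ x ∈ spectrum ℝ A, g ≤ |x - 1 / 2|)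
    (hBg : ∀ x ∈ spectrum ℝ B, g ≤ |x - 1 / 2|) :
    ‖specProj A * (1 - specProj B)‖ * (2 * g) ≤ ‖A - B‖ := by
  set P := specProj A with hP
  set Q := specProj B with hQ
  have hPp : IsStarProjection P := isStarProjection_specProj A
  have hQp : IsStarProjection (1 - Q) := (isStarProjection_specProj B).one_sub
  -- After adding the large scalar `c`, `A + c` is bounded below by `c + 1/2 + g` on the range of
  -- `P`, and `B + c` has norm at most `c + 1/2 - g` on the range of `1 - Q`; the difference of these
  -- bounds is the gap `2 g`.
  obtain ⟨c, hc, hBc⟩ : ∃ c : ℝ, g ≤ c ∧ ∀ x ∈ spectrum ℝ B, -(c + 1 / 2 - g) ≤ x + c := by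
    refine ⟨‖B‖ + g, by simp, fun x hx => ?_⟩
    have h1 := spectrum.norm_le_norm_mul_of_mem hx
    have h2 := norm_one_matrix_le (𝕜 := 𝕜) (n := n)
    have h3 : -‖B‖ ≤ x := by
      have := (abs_le.mp (Real.norm_eq_abs x ▸ h1)).1
      nlinarith [norm_nonneg B]
    linarith [norm_nonneg B]
  set K := cfc (fun x : ℝ => (if 1 / 2 ≤ x then 1 else 0) / (x + c)) A with hK
  set F := cfc (fun x : ℝ => (1 - if 1 / 2 ≤ x then 1 else 0) * (x + c)) B with hF
  set a := algebraMap ℝ (Matrix (Fin n) (Fin n) 𝕜) c with ha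
  have hAc : cfc (fun x : ℝ => x + c) A = A + a := by
    rw [cfc_add_const c _ A (continuousOn_spectrum _ _) hA, cfc_id' ℝ A hA]
  have hBc' : cfc (fun x : ℝ => x + c) B = B + a := by
    rw [cfc_add_const c _ B (continuousOn_spectrum _ _) hB, cfc_id' ℝ B hB]
  have hKP : K * (A + a) = P := by
    rw [hK, ← hAc, ← cfc_mul _ _ A (continuousOn_spectrum _ _) (continuousOn_spectrum _ _)]
    refine cfc_congr fun x _ => ?_
    by_cases h : 1 / 2 ≤ x
    · have : x + c ≠ 0 := by linarith
      simp only [if_pos h, one_div_mul_cancel this]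
    · simp only [if_neg h, zero_div, zero_mul]
  have hQF : (1 - Q) * (B + a) = F := by
    have h1 : 1 - Q = cfc (fun x : ℝ => 1 - if 1 / 2 ≤ x then 1 else 0) B := by
      rw [cfc_sub _ _ B (continuousOn_spectrum _ _) (continuousOn_spectrum _ _),
        cfc_const_one ℝ B hB, hQ, specProj]
    rw [h1, hF, ← hBc', ← cfc_mul _ _ B (continuousOn_spectrum _ _) (continuousOn_spectrum _ _)]
  have hβ : 0 < c + 1 / 2 + g := by linarith
  have hKn : ‖K‖ ≤ (c + 1 / 2 + g)⁻¹ := by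
    refine norm_cfc_le (inv_nonneg.mpr hβ.le) fun x hx => ?_
    by_cases h : 1 / 2 ≤ x
    · have h2 := hAg x hx
      rw [abs_of_nonneg (by linarith)] at h2
      have h3 : 0 < x + c := by linarith
      rw [if_pos h, one_div, Real.norm_eq_abs, abs_of_pos (inv_pos.mpr h3)]
      exact inv_anti₀ hβ (by linarith)
    · simp only [if_neg h, zero_div, norm_zero]
      exact inv_nonneg.mpr hβ.le
  have hFn : ‖F‖ ≤ c + 1 / 2 - g := by
    refine norm_cfc_le (by linarith) fun x hx => ?_
    by_cases h : 1 / 2 ≤ x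
    · simp only [if_pos h, sub_self, zero_mul, norm_zero]
      linarith
    · have h2 := hBg x hx
      rw [abs_of_neg (by linarith)] at h2
      simp only [if_neg h, sub_zero, one_mul, Real.norm_eq_abs]
      exact abs_le.mpr ⟨hBc x hx, by linarith⟩
  set X := P * (1 - Q) with hX
  have hPA : P * (A + a) = (A + a) * P := by
    rw [← hAc]; exact cfc_commute_cfc _ _ A
  have hXeq : X = K * (P * (A - B) * (1 - Q) + X * F) := by
    have h1 : P * (A - B) * (1 - Q) + X * F = (A + a) * X := by
      rw [← hQF, hX]
      have h2 : (1 - Q) * (B + a) = (B + a) * (1 - Q) := by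
        have : (B + a) * Q = Q * (B + a) := by rw [← hBc']; exact cfc_commute_cfc _ _ B
        rw [sub_mul, mul_sub, this, one_mul, mul_one]
      have h3 := hQp.isIdempotentElem.eq
      calc P * (A - B) * (1 - Q) + P * (1 - Q) * ((1 - Q) * (B + a))
          = P * (A - B) * (1 - Q) + P * (((1 - Q) * (1 - Q)) * (B + a)) := by noncomm_ring
        _ = P * (A - B) * (1 - Q) + P * ((B + a) * (1 - Q)) := by rw [h3, h2]
        _ = P * (A + a) * (1 - Q) := by noncomm_ring
        _ = (A + a) * (P * (1 - Q)) := by rw [hPA, mul_assoc]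
    rw [h1, ← mul_assoc, hKP, hX, ← mul_assoc, hPp.isIdempotentElem.eq]
  have hD : ‖P * (A - B) * (1 - Q)‖ ≤ ‖A - B‖ := by
    have h1 := hPp.norm_le
    have h2 := hQp.norm_le
    calc _ ≤ ‖P‖ * ‖A - B‖ * ‖1 - Q‖ := norm_mul₃_le
      _ ≤ 1 * ‖A - B‖ * 1 := by gcongr
      _ = _ := by ring
  have hfin : ‖X‖ ≤ (c + 1 / 2 + g)⁻¹ * (‖A - B‖ + ‖X‖ * (c + 1 / 2 - g)) :=
    calc ‖X‖ = ‖K * (P * (A - B) * (1 - Q) + X * F)‖ := congrArg _ hXeq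
      _ ≤ ‖K‖ * ‖P * (A - B) * (1 - Q) + X * F‖ := norm_mul_le _ _
      _ ≤ (c + 1 / 2 + g)⁻¹ * (‖A - B‖ + ‖X‖ * (c + 1 / 2 - g)) := by
        refine mul_le_mul hKn ?_ (norm_nonneg _) (inv_nonneg.mpr hβ.le)
        refine (norm_add_le _ _).trans (add_le_add hD ((norm_mul_le _ _).trans ?_))
        exact mul_le_mul_of_nonneg_left hFn (norm_nonneg _)
  rw [inv_mul_eq_div, le_div_iff₀ hβ] at hfin
  linarith

/-- The spectral projection is Lipschitz with constant `(2 g)⁻¹` on the set of self-adjoint matrices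
whose spectrum keeps distance `g` from `1/2`. -/
lemma norm_specProj_sub_le {A B : Matrix (Fin n) (Fin n) 𝕜} (hA : IsSelfAdjoint A)
    (hB : IsSelfAdjoint B) {g : ℝ} (hg : 0 < g) (hAg : ∀ x ∈ spectrum ℝ A, g ≤ |x - 1 / 2|)
    (hBg : ∀ x ∈ spectrum ℝ B, g ≤ |x - 1 / 2|) :
    ‖specProj A - specProj B‖ ≤ ‖A - B‖ / (2 * g) := by
  have hP := isStarProjection_specProj A
  have hQ := isStarProjection_specProj B
  refine norm_sub_le_of_blocks hP hQ (by positivity) ?_ ?_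
  · rw [le_div_iff₀ (by positivity)]
    exact norm_specProj_mul_one_sub_le hA hB hg hAg hBg
  · rw [← norm_star, star_mul, star_sub, star_one, hP.isSelfAdjoint.star_eq,
      hQ.isSelfAdjoint.star_eq, le_div_iff₀ (by positivity), norm_sub_rev A B]
    exact norm_specProj_mul_one_sub_le hB hA hg hBg hAg

/-- Matrices at distance at most `η < 1/2` from the set of projections. -/
def nearProjections (𝕜 : Type*) [RCLike 𝕜] (n : ℕ) (η : ℝ) : Set (Matrix (Fin n) (Fin n) 𝕜) :=
  {A | IsSelfAdjoint A ∧ ∃ P, IsStarProjection P ∧ ‖A - P‖ ≤ η}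

lemma lipschitzOnWith_specProj {η : ℝ} (hη : η < 1 / 2) :
    LipschitzOnWith (Real.toNNReal (1 - 2 * η)⁻¹) specProj (nearProjections 𝕜 n η) := by
  refine LipschitzOnWith.of_dist_le_mul fun A ⟨hA, P, hP, hAP⟩ B ⟨hB, Q, hQ, hBQ⟩ => ?_
  have := norm_specProj_sub_le hA hB (g := 1 / 2 - η) (by linarith)
    (fun x => le_abs_sub_half_of_mem_spectrum hP hAP)
    (fun x => le_abs_sub_half_of_mem_spectrum hQ hBQ)
  rw [dist_eq_norm, dist_eq_norm, Real.coe_toNNReal _ (inv_nonneg.mpr (by linarith))]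
  refine this.trans_eq ?_
  rw [div_eq_inv_mul, mul_sub]
  norm_num

end SpectralProjection
/-! ### Similar projections and isomorphic bundles -/

section Similar

/-- Idempotents at distance less than one in a complete normed ring are similar: the element
`u = b a + (1 - b) (1 - a)` intertwines them, and with `v = a b + (1 - a) (1 - b)` both `u v` and
`v u` equal `1 - (a - b) ^ 2`. -/
lemma exists_unit_mul_eq_of_norm_sub_lt_one {R : Type*} [NormedRing R] [HasSummableGeomSeries R]
    {a b : R} (ha : IsIdempotentElem a) (hb : IsIdempotentElem b) (h : ‖a - b‖ < 1) :
    ∃ u : Rˣ, (u : R) * a = b * u := by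
  have ha' := ha.eq
  have hb' := hb.eq
  have hunit : IsUnit (1 - (a - b) * (a - b)) := by
    refine isUnit_one_sub_of_norm_lt_one ?_
    nlinarith [norm_mul_le (a - b) (a - b), norm_nonneg (a - b)]
  have huv : (b * a + (1 - b) * (1 - a)) * (a * b + (1 - a) * (1 - b))
      = 1 - (a - b) * (a - b) := by
    linear_combination (norm := noncomm_ring) b * ha' * b - b * ha' * (1 - b) - (1 - b) * ha' * b
      + (1 - b) * ha' * (1 - b) + ha' + 2 * hb'
  have hvu : (a * b + (1 - a) * (1 - b)) * (b * a + (1 - b) * (1 - a))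
      = 1 - (a - b) * (a - b) := by
    linear_combination (norm := noncomm_ring) a * hb' * a - a * hb' * (1 - a) - (1 - a) * hb' * a
      + (1 - a) * hb' * (1 - a) + hb' + 2 * ha'
  obtain ⟨w, hw⟩ := hunit
  have hu : IsUnit (b * a + (1 - b) * (1 - a)) := by
    rw [isUnit_iff_exists_and_exists]
    refine ⟨⟨(a * b + (1 - a) * (1 - b)) * (↑w⁻¹ : R), ?_⟩,
      ⟨(↑w⁻¹ : R) * (a * b + (1 - a) * (1 - b)), ?_⟩⟩
    · rw [← mul_assoc, huv, ← hw, Units.mul_inv]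
    · rw [mul_assoc, hvu, ← hw, Units.inv_mul]
  refine ⟨hu.unit, ?_⟩
  rw [IsUnit.unit_spec]
  linear_combination (norm := noncomm_ring) (2 * b - 1) * ha' - hb' * (2 * a - 1)

/-- Idempotents joined by a path of idempotents are similar. -/
lemma exists_unit_mul_eq_of_path {R : Type*} [NormedRing R] [HasSummableGeomSeries R]
    {a b : R} (γ : Path a b) (hγ : ∀ t, IsIdempotentElem (γ t)) :
    ∃ u : Rˣ, (u : R) * a = b * u := by
  have key := isPreconnected_univ.induction₂ (α := unitInterval)
    (fun s t => ∃ u : Rˣ, (u : R) * γ s = γ t * u)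
    (fun s _ => by
      have hc : ContinuousAt (fun t => ‖γ s - γ t‖) s :=
        (continuous_const.sub γ.continuous).norm.continuousAt
      have h0 : ∀ᶠ t in nhds s, ‖γ s - γ t‖ < 1 :=
        hc.eventually_lt continuousAt_const (by simp)
      rw [nhdsWithin_univ]
      filter_upwards [h0] with t ht
      exact exists_unit_mul_eq_of_norm_sub_lt_one (hγ s) (hγ t) ht)
    (fun x y z _ _ _ ⟨u, hu⟩ ⟨v, hv⟩ => ⟨v * u, by
      rw [Units.val_mul, mul_assoc, hu, ← mul_assoc, hv, mul_assoc]⟩)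
    (fun x y _ _ ⟨u, hu⟩ => ⟨u⁻¹, by
      rw [Units.inv_mul_eq_iff_eq_mul, ← mul_assoc, hu, mul_assoc, Units.mul_inv, mul_one]⟩)
    (Set.mem_univ 0) (Set.mem_univ 1)
  simpa using key

variable {𝕜 : Type*} [RCLike 𝕜] {n : ℕ} {Y : Type*} [TopologicalSpace Y]

lemma mulVec_mem_fiber {q₀ q₁ u : C(Y, Matrix (Fin n) (Fin n) 𝕜)} (h : u * q₀ = q₁ * u) {y : Y}
    {v : Fin n → 𝕜} (hv : v ∈ fiber q₀ y) : (u y).mulVec v ∈ fiber q₁ y := by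
  obtain ⟨w, rfl⟩ := hv
  refine ⟨(u y).mulVec w, ?_⟩
  have := DFunLike.congr_fun h y
  simp only [ContinuousMap.mul_apply] at this
  simp only [Matrix.mulVecLin_apply, Matrix.mulVec_mulVec, this]

/-- The map of total spaces given by an intertwining matrix function. -/
def totalSpaceMap {q₀ q₁ u : C(Y, Matrix (Fin n) (Fin n) 𝕜)} (h : u * q₀ = q₁ * u)
    (w : TotalSpace q₀) : TotalSpace q₁ :=
  ⟨(w.1.1, (u w.1.1).mulVec w.1.2), mulVec_mem_fiber h w.2⟩

lemma continuous_totalSpaceMap {q₀ q₁ u : C(Y, Matrix (Fin n) (Fin n) 𝕜)}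
    (h : u * q₀ = q₁ * u) : Continuous (totalSpaceMap h) := by
  refine Continuous.subtype_mk (Continuous.prodMk (by fun_prop) ?_) _
  exact Continuous.matrix_mulVec (u.continuous.comp (by fun_prop)) (by fun_prop)

/-- Intertwining projections by an invertible matrix function makes the bundles isomorphic. -/
lemma bundleIsomorphic_of_unit {q₀ q₁ : C(Y, Matrix (Fin n) (Fin n) 𝕜)}
    (u : C(Y, Matrix (Fin n) (Fin n) 𝕜)ˣ)
    (h : (u : C(Y, Matrix (Fin n) (Fin n) 𝕜)) * q₀ = q₁ * u) : BundleIsomorphic q₀ q₁ := by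
  have h' : (↑u⁻¹ : C(Y, Matrix (Fin n) (Fin n) 𝕜)) * q₁ = q₀ * ↑u⁻¹ := by
    rw [Units.inv_mul_eq_iff_eq_mul, ← mul_assoc, h, mul_assoc, Units.mul_inv, mul_one]
  have e1 : ∀ y v, ((↑u⁻¹ : C(Y, Matrix (Fin n) (Fin n) 𝕜)) y).mulVec
      (((u : C(Y, Matrix (Fin n) (Fin n) 𝕜)) y).mulVec v) = v := fun y v => by
    have := DFunLike.congr_fun u.inv_mul y
    simp only [ContinuousMap.mul_apply, ContinuousMap.one_apply] at this
    rw [Matrix.mulVec_mulVec, this, Matrix.one_mulVec]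
  have e2 : ∀ y v, ((u : C(Y, Matrix (Fin n) (Fin n) 𝕜)) y).mulVec
      (((↑u⁻¹ : C(Y, Matrix (Fin n) (Fin n) 𝕜)) y).mulVec v) = v := fun y v => by
    have := DFunLike.congr_fun u.mul_inv y
    simp only [ContinuousMap.mul_apply, ContinuousMap.one_apply] at this
    rw [Matrix.mulVec_mulVec, this, Matrix.one_mulVec]
  refine ⟨{
      toFun := totalSpaceMap h
      invFun := totalSpaceMap h'
      left_inv := fun w => Subtype.ext (Prod.ext rfl (e1 _ _))
      right_inv := fun w => Subtype.ext (Prod.ext rfl (e2 _ _))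
      continuous_toFun := continuous_totalSpaceMap h
      continuous_invFun := continuous_totalSpaceMap h' },
    fun y => LinearEquiv.ofLinearMap
      (((Matrix.mulVecLin _).domRestrict _).codRestrict _ fun v => mulVec_mem_fiber h v.2)
      (((Matrix.mulVecLin _).domRestrict _).codRestrict _ fun v => mulVec_mem_fiber h' v.2)
      (LinearMap.ext fun v => Subtype.ext (e2 y v))
      (LinearMap.ext fun v => Subtype.ext (e1 y v)), fun y v => rfl⟩

end Similar
/-! ### The extension constant -/

section Extension

lemma lip_le_iff {Z E : Type*} [MetricSpace Z] [NormedAddCommGroup E] {f : Z → E} {K : ℝ≥0} :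
    lip f ≤ K ↔ LipschitzWith K f := by
  rw [lipschitzWith_iff_dist_le_mul]
  simp only [lip, iSup_le_iff]
  refine forall₂_congr fun x y => ?_
  constructor
  · intro h
    rcases eq_or_ne x y with rfl | hxy
    · simp
    · have := h hxy
      rw [ENNReal.ofReal_le_coe, div_le_iff₀ (dist_pos.mpr hxy)] at this
      rwa [dist_eq_norm]
  · intro h hxy
    rw [ENNReal.ofReal_le_coe, div_le_iff₀ (dist_pos.mpr hxy), ← dist_eq_norm]
    exact h

/-- The McShane extension of a family of real functions, as a function of both the function `h` on
the subspace and the point `z`. -/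
noncomputable def mcShane {Z : Type*} [MetricSpace Z] {X : Set Z} (N : ℝ≥0) (h : C(X, ℝ)) (z : Z) :
    ℝ :=
  ⨅ x : X, (h x + N * dist (x : Z) z)

section McShane

variable {Z : Type*} [MetricSpace Z] {X : Set Z} [CompactSpace X] (N : ℝ≥0)

lemma mcShane_le (h : C(X, ℝ)) (z : Z) (x : X) : mcShane N h z ≤ h x + N * dist (x : Z) z := by
  refine ciInf_le ⟨-‖h‖, ?_⟩ x
  rintro _ ⟨y, rfl⟩
  have := (abs_le.mp (h.norm_coe_le_norm y)).1
  have : 0 ≤ N * dist (y : Z) z := by positivity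
  dsimp only
  linarith

lemma mcShane_sub_le [Nonempty X] (h h' : C(X, ℝ)) (z z' : Z) :
    mcShane N h z - mcShane N h' z' ≤ dist h h' + N * dist z z' := by
  suffices mcShane N h z - (dist h h' + N * dist z z') ≤ mcShane N h' z' by linarith
  refine le_ciInf fun x => ?_
  have h1 := mcShane_le N h z x
  have h2 := (abs_le.mp ((Real.dist_eq _ _).symm.trans_le
    (ContinuousMap.dist_apply_le_dist (f := h) (g := h') x))).2
  have h3 : N * dist (x : Z) z ≤ N * dist (x : Z) z' + N * dist z z' := by
    rw [← mul_add, dist_comm z z']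
    exact mul_le_mul_of_nonneg_left (dist_triangle _ _ _) N.2
  linarith

lemma abs_mcShane_sub_le [Nonempty X] (h h' : C(X, ℝ)) (z z' : Z) :
    |mcShane N h z - mcShane N h' z'| ≤ dist h h' + N * dist z z' :=
  abs_sub_le_iff.mpr ⟨mcShane_sub_le N h h' z z', by
    rw [dist_comm h h', dist_comm z z']; exact mcShane_sub_le N h' h z' z⟩

lemma mcShane_eq [Nonempty X] {h : C(X, ℝ)} (hh : LipschitzWith N h) (x : X) :
    mcShane N h x = h x := by
  refine le_antisymm ((mcShane_le N h x x).trans_eq (by simp)) (le_ciInf fun y => ?_)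
  have := (abs_le.mp ((Real.dist_eq _ _).symm.trans_le (hh.dist_le_mul x y))).2
  rw [dist_comm x y, Subtype.dist_eq] at this
  linarith

lemma continuous_mcShane [Nonempty X] : Continuous fun w : C(X, ℝ) × Z => mcShane N w.1 w.2 := by
  refine LipschitzWith.continuous (K := 1 + N) (LipschitzWith.of_dist_le_mul fun w w' => ?_)
  rw [Real.dist_eq]
  refine (abs_mcShane_sub_le N _ _ _ _).trans ?_
  rw [Prod.dist_eq, NNReal.coe_add, NNReal.coe_one, add_mul, one_mul]
  gcongr
  · exact le_max_left _ _
  · exact le_max_right _ _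

end McShane

/-- The radial retraction of a normed space onto the ball of radius `R`. -/
noncomputable def radialRetract {E : Type*} [NormedAddCommGroup E] [NormedSpace ℝ E] (R : ℝ)
    (v : E) : E :=
  (R / max R ‖v‖) • v

section Radial

variable {E : Type*} [NormedAddCommGroup E] [NormedSpace ℝ E] {R : ℝ}

lemma radialRetract_eq_self {v : E} (hv : ‖v‖ ≤ R) : radialRetract R v = v := by
  rw [radialRetract, max_eq_left hv]
  rcases eq_or_ne R 0 with rfl | h
  · simp [norm_le_zero_iff.mp hv]
  · rw [div_self h, one_smul]

lemma norm_radialRetract_le (hR : 0 ≤ R) (v : E) : ‖radialRetract R v‖ ≤ R := by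
  rw [radialRetract, norm_smul, Real.norm_eq_abs, abs_of_nonneg (by positivity), div_mul_eq_mul_div,
    mul_div_assoc]
  exact mul_le_of_le_one_right hR (div_le_one_of_le₀ (le_max_right _ _) (by positivity))

lemma lipschitzWith_radialRetract (hR : 0 ≤ R) :
    LipschitzWith 2 (radialRetract R : E → E) := by
  refine LipschitzWith.of_dist_le_mul fun v w => ?_
  rcases hR.eq_or_lt with rfl | hR
  · simp [radialRetract]
  set a := max R ‖v‖ with ha
  set b := max R ‖w‖ with hb
  have ha0 : 0 < a := lt_max_of_lt_left hR
  have hb0 : 0 < b := lt_max_of_lt_left hR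
  have hab : |b - a| ≤ ‖v - w‖ := by
    rw [abs_sub_comm]
    refine (abs_max_sub_max_le_max R ‖v‖ R ‖w‖).trans ?_
    simpa using abs_norm_sub_norm_le v w
  have key : radialRetract R v - radialRetract R w
      = (R / a) • (v - w) + ((R / a) * ((b - a) / b)) • w := by
    have : (R / a) * ((b - a) / b) = R / a - R / b := by field_simp
    rw [this, radialRetract, radialRetract, ← ha, ← hb]
    module
  have h1 : R / a ≤ 1 := div_le_one_of_le₀ (le_max_left _ _) ha0.le
  rw [dist_eq_norm, dist_eq_norm, key]
  refine (norm_add_le _ _).trans ?_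
  rw [norm_smul, norm_smul, Real.norm_eq_abs, Real.norm_eq_abs, abs_mul, abs_div (b - a),
    abs_of_pos hb0, abs_of_pos (div_pos hR ha0), mul_assoc]
  have h2 : |b - a| / b * ‖w‖ ≤ ‖v - w‖ := by
    rw [div_mul_eq_mul_div, mul_div_assoc]
    refine (mul_le_of_le_one_right (abs_nonneg _) ?_).trans hab
    exact div_le_one_of_le₀ (le_max_right _ _) hb0.le
  have h3 : R / a * ‖v - w‖ ≤ 1 * ‖v - w‖ := by gcongr
  have h4 : R / a * (|b - a| / b * ‖w‖) ≤ 1 * ‖v - w‖ :=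
    mul_le_mul h1 h2 (by positivity) zero_le_one
  push_cast
  linarith

end Radial

/-- Simultaneous extension of Lipschitz families with values in a finite-dimensional normed space:
extend the coordinates by the McShane formula, then retract onto a ball. -/
lemma exists_extension_of_finiteDimensional (E : Type*) [NormedAddCommGroup E] [NormedSpace ℝ E]
    [FiniteDimensional ℝ E] :
    ∃ c : ℝ≥0, ∀ (Z T : Type) [MetricSpace Z] [CompactSpace Z] [TopologicalSpace T]
      [CompactSpace T] (X : Set Z), IsClosed X → ∀ (F : C(X × T, E)) (N : ℝ≥0),
      (∀ t : T, LipschitzWith N fun x : X => F (x, t)) →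
      ∃ G : C(Z × T, E), (∀ (x : X) (t : T), G ((x : Z), t) = F (x, t)) ∧
        (∀ t : T, LipschitzWith (c * N) fun z : Z => G (z, t)) ∧
        (⨆ w : Z × T, ‖G w‖ₑ) = ⨆ w : X × T, ‖F w‖ₑ := by
  set e : E ≃L[ℝ] (Fin (Module.finrank ℝ E) → ℝ) :=
    ContinuousLinearEquiv.ofFinrankEq (by simp) with he
  refine ⟨2 * (‖(e.symm : (Fin (Module.finrank ℝ E) → ℝ) →L[ℝ] E)‖₊ *
      ‖(e : E →L[ℝ] Fin (Module.finrank ℝ E) → ℝ)‖₊), ?_⟩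
  intro Z T _ _ _ _ X hX F N hF
  rcases isEmpty_or_nonempty (X × T) with hXT | hXT
  · refine ⟨0, fun x t => (hXT.false (x, t)).elim, fun t => LipschitzWith.const' 0, by simp⟩
  have hXc : CompactSpace X := isCompact_iff_compactSpace.mp hX.isCompact
  have hXn : Nonempty X := hXT.map Prod.fst
  -- The norm of `F` is attained.
  obtain ⟨w₀, -, hw₀⟩ := isCompact_univ.exists_isMaxOn Set.univ_nonempty
    (F.continuous.norm).continuousOn
  have hmax : ∀ w, ‖F w‖ ≤ ‖F w₀‖ := fun w => hw₀ (Set.mem_univ w)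
  set R := ‖F w₀‖ with hR
  -- The coordinates of the family, as continuous functions of the parameter.
  let f : Fin (Module.finrank ℝ E) → C(T, C(X, ℝ)) := fun i =>
    ContinuousMap.curry ⟨fun w => e (F (w.2, w.1)) i, by fun_prop⟩
  set M : ℝ≥0 := ‖(e : E →L[ℝ] Fin (Module.finrank ℝ E) → ℝ)‖₊ * N with hM
  have hf : ∀ i t, LipschitzWith M (f i t) := fun i t => by
    have h1 : LipschitzWith M fun x : X => e (F (x, t)) :=
      (e : E →L[ℝ] Fin (Module.finrank ℝ E) → ℝ).lipschitz.comp (hF t)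
    refine LipschitzWith.of_dist_le_mul fun x y => ?_
    exact (dist_le_pi_dist _ _ i).trans (h1.dist_le_mul x y)
  let g : Z × T → Fin (Module.finrank ℝ E) → ℝ := fun w i => mcShane M (f i w.2) w.1
  have hg : Continuous g := continuous_pi fun i =>
    (continuous_mcShane M).comp (((f i).continuous.comp continuous_snd).prodMk continuous_fst)
  have hgl : ∀ t, LipschitzWith M fun z => g (z, t) := fun t =>
    LipschitzWith.of_dist_le_mul fun z z' => by
      refine (dist_pi_le_iff (by positivity)).mpr fun i => ?_
      rw [Real.dist_eq]
      exact (abs_mcShane_sub_le M (f i t) (f i t) z z').trans_eq (by simp)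
  have hge : ∀ (x : X) t, g (x, t) = e (F (x, t)) := fun x t =>
    funext fun i => mcShane_eq M (hf i t) x
  have hres : ∀ (x : X) (t : T), radialRetract R (e.symm (g (x, t))) = F (x, t) := fun x t => by
    rw [hge, e.symm_apply_apply, radialRetract_eq_self (hmax _)]
  refine ⟨⟨fun w => radialRetract R (e.symm (g w)),
    (lipschitzWith_radialRetract (norm_nonneg _)).continuous.comp (e.symm.continuous.comp hg)⟩,
    hres, fun t => ?_, le_antisymm (iSup_le fun w => ?_) (iSup_le fun w => ?_)⟩
  · have := (lipschitzWith_radialRetract (E := E) (norm_nonneg (F w₀))).comp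
      ((e.symm : (Fin (Module.finrank ℝ E) → ℝ) →L[ℝ] E).lipschitz.comp (hgl t))
    rw [show 2 * (‖(e.symm : (Fin (Module.finrank ℝ E) → ℝ) →L[ℝ] E)‖₊ *
      ‖(e : E →L[ℝ] Fin (Module.finrank ℝ E) → ℝ)‖₊) * N
      = 2 * (‖(e.symm : (Fin (Module.finrank ℝ E) → ℝ) →L[ℝ] E)‖₊ * M) by rw [hM]; ring]
    exact this
  · refine le_trans ?_ (le_iSup (fun w : X × T => ‖F w‖ₑ) w₀)
    rw [enorm_le_iff_norm_le]
    exact norm_radialRetract_le (norm_nonneg _) _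
  · refine le_trans (le_of_eq ?_) (le_iSup _ ((w.1 : Z), w.2))
    exact congrArg _ (hres w.1 w.2).symm

lemma exists_isExtensionConst (n : ℕ) : ∃ c, IsExtensionConst n c := by
  have : FiniteDimensional ℝ (selfAdjoint (Matrix (Fin n) (Fin n) ℂ)) :=
    FiniteDimensional.of_injective (selfAdjoint.submodule ℝ (Matrix (Fin n) (Fin n) ℂ)).subtype
      Subtype.val_injective
  obtain ⟨c, hc⟩ :=
    exists_extension_of_finiteDimensional (selfAdjoint (Matrix (Fin n) (Fin n) ℂ))
  refine ⟨c, fun Z T _ _ _ _ X hX F N hF => ?_⟩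
  obtain ⟨G, h1, h2, h3⟩ := hc Z T X hX F N fun t => lip_le_iff.mp (hF t)
  exact ⟨G, h1, fun t => by rw [← ENNReal.coe_mul]; exact lip_le_iff.mpr (h2 t), h3⟩

/-- The function `x ↦ x • 1` on the unit interval, extended from the whole interval, shows that an
extension constant is at least one. -/
lemma one_le_of_isExtensionConst {n : ℕ} (hn : 0 < n) {c : ℝ≥0} (hc : IsExtensionConst n c) :
    1 ≤ c := by
  have : Nonempty (Fin n) := ⟨⟨0, hn⟩⟩
  have hd : ∀ a b : ℝ, dist (a • (1 : Matrix (Fin n) (Fin n) ℂ)) (b • 1) = dist a b := fun a b => by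
    rw [dist_eq_norm, ← sub_smul, norm_smul, CStarRing.norm_one, mul_one, dist_eq_norm]
  let F : C(↥(Set.univ : Set unitInterval) × Unit, selfAdjoint (Matrix (Fin n) (Fin n) ℂ)) :=
    ⟨fun w => ⟨((w.1 : unitInterval) : ℝ) • (1 : Matrix (Fin n) (Fin n) ℂ),
      IsSelfAdjoint.smul (IsSelfAdjoint.all _) (IsSelfAdjoint.one _)⟩, by fun_prop⟩
  obtain ⟨G, h1, h2, -⟩ := hc unitInterval Unit Set.univ isClosed_univ F 1 fun t =>
    lip_le_iff.mpr (LipschitzWith.of_dist_le_mul fun x y => by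
      rw [NNReal.coe_one, one_mul]; exact (hd _ _).le)
  have h3 := h2 ()
  rw [← ENNReal.coe_mul, mul_one, lip_le_iff] at h3
  have h4 := h3.dist_le_mul 0 1
  have e0 := h1 ⟨0, trivial⟩ ()
  have e1 := h1 ⟨1, trivial⟩ ()
  dsimp only at e0 e1 h4
  rw [e0, e1] at h4
  have h5 : dist (0 : unitInterval) 1 = 1 := by
    rw [Subtype.dist_eq]; simp
  have h6 := (hd ((0 : unitInterval) : ℝ) ((1 : unitInterval) : ℝ)).symm.trans_le h4
  rw [← Subtype.dist_eq, h5, mul_one] at h6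
  exact_mod_cast h6

lemma one_le_extensionConst {n : ℕ} (hn : 0 < n) : 1 ≤ extensionConst n :=
  le_csInf (exists_isExtensionConst n) fun _ hc => one_le_of_isExtensionConst hn hc

lemma exists_isExtensionConst_lt {n : ℕ} {b : ℝ≥0} (hb : extensionConst n < b) :
    ∃ c, IsExtensionConst n c ∧ c < b :=
  exists_lt_of_csInf_lt (exists_isExtensionConst n) hb

end Extension
/-! ### Extension of families of self-adjoint matrices over `𝕜` -/

section Scalars

variable {𝕜 : Type*} [RCLike 𝕜] {n : ℕ}

/-- The complex matrix with the same real and imaginary parts as a matrix over `𝕜`. -/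
noncomputable def toComplex (A : Matrix (Fin n) (Fin n) 𝕜) : Matrix (Fin n) (Fin n) ℂ :=
  A.map (RCLike.map 𝕜 ℂ)

/-- The matrix over `𝕜` with the same real and imaginary parts as a complex matrix; for `𝕜 = ℝ`
this is the entrywise real part. -/
noncomputable def ofComplex (A : Matrix (Fin n) (Fin n) ℂ) : Matrix (Fin n) (Fin n) 𝕜 :=
  A.map (RCLike.map ℂ 𝕜)

lemma map_map_eq_self (z : 𝕜) : RCLike.map ℂ 𝕜 (RCLike.map 𝕜 ℂ z) = z := by
  simp

lemma norm_map_eq (z : 𝕜) : ‖RCLike.map 𝕜 ℂ z‖ = ‖z‖ := by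
  rw [← sq_eq_sq₀ (norm_nonneg _) (norm_nonneg _), RCLike.norm_sq_eq_def, RCLike.norm_sq_eq_def]
  simp

lemma norm_map_le (z : ℂ) : ‖RCLike.map ℂ 𝕜 z‖ ≤ ‖z‖ := by
  rw [← sq_le_sq₀ (norm_nonneg _) (norm_nonneg _), RCLike.norm_sq_eq_def, RCLike.norm_sq_eq_def]
  rcases RCLike.I_eq_zero_or_im_I_eq_one (K := 𝕜) with h | h
  · simp [h, mul_self_nonneg]
  · simp [h]

lemma map_mul_map (z : ℂ) (w : 𝕜) :
    RCLike.map ℂ 𝕜 (z * RCLike.map 𝕜 ℂ w) = RCLike.map ℂ 𝕜 z * w := by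
  rcases RCLike.I_eq_zero_or_im_I_eq_one (K := 𝕜) with h | h
  · have hw := RCLike.im_eq_zero h w
    apply RCLike.ext <;> simp [h, hw]
  · apply RCLike.ext <;> simp [h]

lemma norm_matrix_le_of_forall {A : Matrix (Fin n) (Fin n) 𝕜} {m : ℝ} (hm : 0 ≤ m)
    (h : ∀ v : Fin n → 𝕜, ‖WithLp.toLp 2 (A.mulVec v)‖ ≤ m * ‖WithLp.toLp 2 v‖) : ‖A‖ ≤ m := by
  rw [Matrix.cstar_norm_def]
  exact ContinuousLinearMap.opNorm_le_bound _ hm fun v => h v.ofLp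

lemma norm_toLp_le_of_forall {𝕜' : Type*} [RCLike 𝕜'] {v : Fin n → 𝕜} {w : Fin n → 𝕜'}
    (h : ∀ i, ‖v i‖ ≤ ‖w i‖) : ‖WithLp.toLp 2 v‖ ≤ ‖WithLp.toLp 2 w‖ := by
  rw [← sq_le_sq₀ (norm_nonneg _) (norm_nonneg _), EuclideanSpace.norm_sq_eq,
    EuclideanSpace.norm_sq_eq]
  exact Finset.sum_le_sum fun i _ => pow_le_pow_left₀ (norm_nonneg _) (h i) 2

lemma norm_ofComplex_le (B : Matrix (Fin n) (Fin n) ℂ) :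
    ‖(ofComplex B : Matrix (Fin n) (Fin n) 𝕜)‖ ≤ ‖B‖ := by
  refine norm_matrix_le_of_forall (norm_nonneg _) fun v => ?_
  have h : (ofComplex B : Matrix (Fin n) (Fin n) 𝕜).mulVec v
      = fun i => RCLike.map ℂ 𝕜 (B.mulVec (fun j => RCLike.map 𝕜 ℂ (v j)) i) := by
    funext i
    simp only [Matrix.mulVec, dotProduct, map_sum, map_mul_map]
    rfl
  rw [h]
  refine (norm_toLp_le_of_forall fun i => norm_map_le _).trans ?_
  refine (Matrix.l2_opNorm_mulVec B (WithLp.toLp 2 fun j => RCLike.map 𝕜 ℂ (v j))).trans ?_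
  gcongr
  exact norm_toLp_le_of_forall fun j => (norm_map_eq _).le

/-- Passing to complex matrices does not increase the norm. When `𝕜` is real, the real and imaginary
parts of a complex vector are mapped separately. -/
lemma norm_toComplex_le (A : Matrix (Fin n) (Fin n) 𝕜) : ‖toComplex A‖ ≤ ‖A‖ := by
  refine norm_matrix_le_of_forall (norm_nonneg _) fun w => ?_
  rcases RCLike.I_eq_zero_or_im_I_eq_one (K := 𝕜) with h | h
  · have key : ∀ i, ‖(toComplex A).mulVec w i‖ ^ 2
        = ‖A.mulVec (fun j => ((w j).re : 𝕜)) i‖ ^ 2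
          + ‖A.mulVec (fun j => ((w j).im : 𝕜)) i‖ ^ 2 := fun i => by
      simp only [RCLike.norm_sq_eq_def, RCLike.im_eq_zero h, Matrix.mulVec, dotProduct, map_sum]
      simp [toComplex, RCLike.im_eq_zero h]
    have h1 := Matrix.l2_opNorm_mulVec A (WithLp.toLp 2 fun j => ((w j).re : 𝕜))
    have h2 := Matrix.l2_opNorm_mulVec A (WithLp.toLp 2 fun j => ((w j).im : 𝕜))
    have c1 := pow_le_pow_left₀ (norm_nonneg _) h1 2
    have c2 := pow_le_pow_left₀ (norm_nonneg _) h2 2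
    have h3 : ‖WithLp.toLp 2 w‖ ^ 2 = ‖WithLp.toLp 2 fun j => ((w j).re : 𝕜)‖ ^ 2
        + ‖WithLp.toLp 2 fun j => ((w j).im : 𝕜)‖ ^ 2 := by
      simp only [EuclideanSpace.norm_sq_eq, ← Finset.sum_add_distrib, RCLike.norm_sq_eq_def]
      simp
    have h4 : ‖WithLp.toLp 2 ((toComplex A).mulVec w)‖ ^ 2
        = ‖WithLp.toLp 2 (A.mulVec fun j => ((w j).re : 𝕜))‖ ^ 2
          + ‖WithLp.toLp 2 (A.mulVec fun j => ((w j).im : 𝕜))‖ ^ 2 := by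
      simp only [EuclideanSpace.norm_sq_eq, ← Finset.sum_add_distrib, key]
    rw [mul_pow] at c1 c2
    refine le_of_sq_le_sq ?_ (by positivity)
    rw [h4, mul_pow, h3, mul_add]
    exact add_le_add c1 c2
  · have e : (toComplex A).mulVec w
        = fun i => RCLike.map 𝕜 ℂ (A.mulVec (fun j => RCLike.map ℂ 𝕜 (w j)) i) := by
      funext i
      simp only [Matrix.mulVec, dotProduct, map_sum]
      refine Finset.sum_congr rfl fun j _ => ?_
      apply RCLike.ext <;> simp [toComplex, h]
    rw [e]
    refine (norm_toLp_le_of_forall fun i => (norm_map_eq _).le).trans ?_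
    refine (Matrix.l2_opNorm_mulVec A (WithLp.toLp 2 fun j => RCLike.map ℂ 𝕜 (w j))).trans ?_
    gcongr
    exact norm_toLp_le_of_forall fun j => norm_map_le _

lemma ofComplex_toComplex (A : Matrix (Fin n) (Fin n) 𝕜) : ofComplex (toComplex A) = A := by
  ext i j
  exact map_map_eq_self _

lemma toComplex_sub (A B : Matrix (Fin n) (Fin n) 𝕜) :
    toComplex (A - B) = toComplex A - toComplex B :=
  Matrix.map_sub _ (map_sub _) _ _

lemma ofComplex_sub (A B : Matrix (Fin n) (Fin n) ℂ) :
    (ofComplex (A - B) : Matrix (Fin n) (Fin n) 𝕜) = ofComplex A - ofComplex B :=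
  Matrix.map_sub _ (map_sub _) _ _

lemma lipschitzWith_toComplex :
    LipschitzWith 1 (toComplex : Matrix (Fin n) (Fin n) 𝕜 → _) :=
  LipschitzWith.of_dist_le_mul fun A B => by
    rw [dist_eq_norm, dist_eq_norm, ← toComplex_sub, NNReal.coe_one, one_mul]
    exact norm_toComplex_le _

lemma lipschitzWith_ofComplex :
    LipschitzWith 1 (ofComplex : _ → Matrix (Fin n) (Fin n) 𝕜) :=
  LipschitzWith.of_dist_le_mul fun A B => by
    rw [dist_eq_norm, dist_eq_norm, ← ofComplex_sub, NNReal.coe_one, one_mul]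
    exact norm_ofComplex_le _

lemma isSelfAdjoint_toComplex {A : Matrix (Fin n) (Fin n) 𝕜} (hA : IsSelfAdjoint A) :
    IsSelfAdjoint (toComplex A) := by
  ext i j
  have : star (A j i) = A i j := congrFun (congrFun hA i) j
  rw [Matrix.star_apply, toComplex, Matrix.map_apply, Matrix.map_apply, ← this]
  apply RCLike.ext <;> simp

lemma isSelfAdjoint_ofComplex {A : Matrix (Fin n) (Fin n) ℂ} (hA : IsSelfAdjoint A) :
    IsSelfAdjoint (ofComplex A : Matrix (Fin n) (Fin n) 𝕜) := by
  ext i j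
  have : star (A j i) = A i j := congrFun (congrFun hA i) j
  rw [Matrix.star_apply, ofComplex, Matrix.map_apply, Matrix.map_apply, ← this]
  apply RCLike.ext <;> simp

end Scalars

section Families

variable {𝕜 : Type*} [RCLike 𝕜] {n : ℕ}

/-- The defining property of an extension constant, for families of self-adjoint matrices over `𝕜`
on a compact space `X` embedded in a compact metric space `Z` of any universe. The space `Z` is
replaced by its image in `ℓ^∞`. -/
lemma IsExtensionConst.exists_extension {c : ℝ≥0} (hc : IsExtensionConst n c) {X Z : Type*}
    [MetricSpace X] [CompactSpace X] [MetricSpace Z] [CompactSpace Z] {T : Type}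
    [TopologicalSpace T] [CompactSpace T] {i : X → Z} (hi : Isometry i)
    (F : C(X × T, Matrix (Fin n) (Fin n) 𝕜)) (hF : ∀ w, IsSelfAdjoint (F w)) {N : ℝ≥0}
    (hN : ∀ t, LipschitzWith N fun x => F (x, t)) :
    ∃ G : C(Z × T, Matrix (Fin n) (Fin n) 𝕜), (∀ w, IsSelfAdjoint (G w)) ∧
      (∀ x t, G (i x, t) = F (x, t)) ∧ ∀ t, LipschitzWith (c * N) fun z => G (z, t) := by
  have hκ := kuratowskiEmbedding.isometry Z
  -- `e` identifies `Z` with a compact metric space in `Type`, and `X` with a closed subset of it.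
  let e := hκ.isometryEquivOnRange
  have hZ : CompactSpace (Set.range (kuratowskiEmbedding Z)) := e.toHomeomorph.compactSpace
  have hei : Isometry (e ∘ i) := e.isometry.comp hi
  let a := hei.isometryEquivOnRange
  let F' : C(↥(Set.range (e ∘ i)) × T, selfAdjoint (Matrix (Fin n) (Fin n) ℂ)) :=
    ⟨fun w => ⟨toComplex (F (a.symm w.1, w.2)), isSelfAdjoint_toComplex (hF _)⟩,
      (lipschitzWith_toComplex.continuous.comp (F.continuous.comp
        ((a.symm.continuous.comp continuous_fst).prodMk continuous_snd))).subtype_mk _⟩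
  obtain ⟨G, hG, hL, -⟩ := hc _ T (Set.range (e ∘ i)) (isCompact_range hei.continuous).isClosed
    F' N fun t => lip_le_iff.mpr <| by
      have := lipschitzWith_toComplex.comp ((hN t).comp a.symm.isometry.lipschitz)
      rw [one_mul, mul_one] at this
      exact fun x y => this x y
  refine ⟨⟨fun w => ofComplex (G (e w.1, w.2) : Matrix (Fin n) (Fin n) ℂ),
    lipschitzWith_ofComplex.continuous.comp (continuous_subtype_val.comp (G.continuous.comp
      ((e.continuous.comp continuous_fst).prodMk continuous_snd)))⟩,
    fun w => isSelfAdjoint_ofComplex (G _).2, fun x t => ?_, fun t => ?_⟩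
  · have h1 := hG (a x) t
    have h2 : ((a x : Set.range (e ∘ i)) : Set.range (kuratowskiEmbedding Z)) = e (i x) := rfl
    rw [h2] at h1
    change ofComplex (G (e (i x), t) : Matrix (Fin n) (Fin n) ℂ) = _
    rw [h1]
    change ofComplex (toComplex (F (a.symm (a x), t))) = _
    rw [a.symm_apply_apply, ofComplex_toComplex]
  · have h1 := hL t
    rw [← ENNReal.coe_mul, lip_le_iff] at h1
    have h2 : LipschitzWith (c * N) fun z =>
        (G (z, t) : Matrix (Fin n) (Fin n) ℂ) := fun x y => h1 x y
    have := lipschitzWith_ofComplex (𝕜 := 𝕜) |>.comp (h2.comp e.isometry.lipschitz)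
    rw [one_mul, mul_one] at this
    exact this

end Families
/-! ### Paths of pairs of projections -/

section Paths

lemma exists_lipschitzWith_of_lip_lt {Z E : Type*} [MetricSpace Z] [NormedAddCommGroup E]
    {f : Z → E} {r : ℝ} (h : lip f < ENNReal.ofReal r) :
    ∃ K : ℝ≥0, (K : ℝ) < r ∧ LipschitzWith K f := by
  obtain ⟨K, h1, h2⟩ := ENNReal.lt_iff_exists_nnreal_btwn.mp h
  refine ⟨K, ?_, lip_le_iff.mp h1.le⟩
  simpa using (ENNReal.lt_ofReal_iff_toReal_lt ENNReal.coe_ne_top).mp h2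

lemma lip_lt_of_lipschitzWith {Z E : Type*} [MetricSpace Z] [NormedAddCommGroup E] {f : Z → E}
    {K : ℝ≥0} {r : ℝ} (hf : LipschitzWith K f) (h : (K : ℝ) < r) : lip f < ENNReal.ofReal r :=
  (lip_le_iff.mpr hf).trans_lt <| by
    rw [← ENNReal.ofReal_coe_nnreal]
    exact (ENNReal.ofReal_lt_ofReal_iff_of_nonneg K.2).mpr h

/-- A Lipschitz function on `X ⊕ Y` that is a projection on `X` is close to projections on `Y` when
each point of `Y` is close to `X`. -/
lemma mem_nearProjections {𝕜 : Type*} [RCLike 𝕜] {n : ℕ} {X Y : Type*} [MetricSpace (X ⊕ Y)]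
    {f : X ⊕ Y → Matrix (Fin n) (Fin n) 𝕜} {K : ℝ≥0} {ε : ℝ}
    (hd : ∀ y : Y, ∃ x : X, dist (Sum.inr y : X ⊕ Y) (Sum.inl x) ≤ ε)
    (hf : LipschitzWith K f) (hX : ∀ x, IsStarProjection (f (Sum.inl x)))
    {y : Y} (hY : IsSelfAdjoint (f (Sum.inr y))) :
    f (Sum.inr y) ∈ nearProjections 𝕜 n (K * ε) := by
  obtain ⟨x, hx⟩ := hd y
  refine ⟨hY, f (Sum.inl x), hX x, ?_⟩
  rw [← dist_eq_norm]
  exact (hf.dist_le_mul _ _).trans (by gcongr)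

variable {𝕜 : Type*} [RCLike 𝕜] {n : ℕ} {X Y : Type*} [MetricSpace X] [MetricSpace Y]
  [MetricSpace (X ⊕ Y)]

variable (𝕜 n X Y) in
/-- The pairs `(p, q)` of projections on `X` and `Y` with `L^ρ(p ⊕ q) < L`. -/
def projectionPairs (L : ℝ) :
    Set (C(X, Matrix (Fin n) (Fin n) 𝕜) × C(Y, Matrix (Fin n) (Fin n) 𝕜)) :=
  {w | w.1 ∈ projections 𝕜 n X ∧ w.2 ∈ projections 𝕜 n Y ∧ lipSum w.1 w.2 < ENNReal.ofReal L}

/-- Replacing a family of self-adjoint functions on `X ⊕ Y` that are projections on `X` by their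
spectral projections gives a path of pairs of projections. -/
lemma joinedIn_projectionPairs (hX : Isometry (Sum.inl : X → X ⊕ Y))
    (hY : Isometry (Sum.inr : Y → X ⊕ Y)) {ε L : ℝ} {K : ℝ≥0} (hε : 0 ≤ ε)
    (hd : ∀ y : Y, ∃ x : X, dist (Sum.inr y : X ⊕ Y) (Sum.inl x) ≤ ε)
    (hKε : K * ε < 1 / 2) (hL : (1 - 2 * (K * ε))⁻¹ * K < L)
    (P : C(X × unitInterval, Matrix (Fin n) (Fin n) 𝕜))
    (H : C(Y × unitInterval, Matrix (Fin n) (Fin n) 𝕜))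
    (hP : ∀ w, IsStarProjection (P w)) (hH : ∀ w, IsSelfAdjoint (H w))
    (hK : ∀ t, LipschitzWith K
      (Sum.elim (fun x => P (x, t)) (fun y => H (y, t)) : X ⊕ Y → Matrix (Fin n) (Fin n) 𝕜)) :
    ∃ Q : C(Y × unitInterval, Matrix (Fin n) (Fin n) 𝕜), (∀ w, Q w = specProj (H w)) ∧
      ∀ (p₀ p₁ : C(X, Matrix (Fin n) (Fin n) 𝕜)) (q₀ q₁ : C(Y, Matrix (Fin n) (Fin n) 𝕜)),
        (∀ x, P (x, 0) = p₀ x) → (∀ x, P (x, 1) = p₁ x) →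
        (∀ y, Q (y, 0) = q₀ y) → (∀ y, Q (y, 1) = q₁ y) →
        JoinedIn (projectionPairs 𝕜 n X Y L) (p₀, q₀) (p₁, q₁) := by
  have hnear : ∀ w, H w ∈ nearProjections 𝕜 n (K * ε) := fun w =>
    mem_nearProjections hd (hK w.2) (fun x => hP _) (hH w)
  let Q : C(Y × unitInterval, Matrix (Fin n) (Fin n) 𝕜) :=
    ⟨fun w => specProj (H w),
      (lipschitzOnWith_specProj hKε).continuousOn.comp_continuous H.continuous hnear⟩
  refine ⟨Q, fun w => rfl, fun p₀ p₁ q₀ q₁ hp₀ hp₁ hq₀ hq₁ => ?_⟩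
  let p : C(unitInterval, C(X, Matrix (Fin n) (Fin n) 𝕜)) :=
    (P.comp ContinuousMap.prodSwap).curry
  let q : C(unitInterval, C(Y, Matrix (Fin n) (Fin n) 𝕜)) :=
    (Q.comp ContinuousMap.prodSwap).curry
  have hlip : ∀ t, LipschitzWith (Real.toNNReal (1 - 2 * (K * ε))⁻¹ * K)
      (Sum.elim (p t) (q t) : X ⊕ Y → Matrix (Fin n) (Fin n) 𝕜) := fun t => by
    have e : (Sum.elim (p t) (q t) : X ⊕ Y → Matrix (Fin n) (Fin n) 𝕜)
        = specProj ∘ Sum.elim (fun x => P (x, t)) (fun y => H (y, t)) := by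
      funext z
      rcases z with x | y
      · exact (specProj_eq_self (hP _)).symm
      · rfl
    rw [e, ← lipschitzOnWith_univ]
    refine (lipschitzOnWith_specProj (𝕜 := 𝕜) (n := n) hKε).comp (hK t).lipschitzOnWith ?_
    rintro (x | y) -
    · refine ⟨(hP _).isSelfAdjoint, P (x, t), hP _, ?_⟩
      rw [Sum.elim_inl, sub_self, norm_zero]
      positivity
    · exact hnear (y, t)
  refine ⟨⟨⟨fun t => (p t, q t), by fun_prop⟩, ?_, ?_⟩, fun t => ⟨⟨fun x => hP _, ?_⟩,
    ⟨fun y => isStarProjection_specProj _, ?_⟩, ?_⟩⟩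
  · exact Prod.ext (ContinuousMap.ext hp₀) (ContinuousMap.ext hq₀)
  · exact Prod.ext (ContinuousMap.ext hp₁) (ContinuousMap.ext hq₁)
  · exact (lip_le_iff.mpr ((hlip t).comp hX.lipschitz)).trans_lt ENNReal.coe_lt_top
  · exact (lip_le_iff.mpr ((hlip t).comp hY.lipschitz)).trans_lt ENNReal.coe_lt_top
  · refine lip_lt_of_lipschitzWith (hlip t) ?_
    rwa [NNReal.coe_mul, Real.coe_toNNReal _ (inv_nonneg.mpr (by linarith))]

/-- Two projections on `Y` that are both close to the same projection `p` on `X` are joined by the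
spectral projections of the segment between them. -/
lemma joinedIn_projectionPairs_of_lipSum_lt (hX : Isometry (Sum.inl : X → X ⊕ Y))
    (hY : Isometry (Sum.inr : Y → X ⊕ Y)) {ε s L : ℝ} (hε : 0 < ε)
    (hd : ∀ y : Y, ∃ x : X, dist (Sum.inr y : X ⊕ Y) (Sum.inl x) ≤ ε)
    (hεs : ε * s < 1 / 2) (hL : (1 - 2 * ε * s)⁻¹ * s < L)
    {p : C(X, Matrix (Fin n) (Fin n) 𝕜)} (hp : p ∈ projections 𝕜 n X)
    {q q' : C(Y, Matrix (Fin n) (Fin n) 𝕜)} (hq : q ∈ projections 𝕜 n Y)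
    (hq' : q' ∈ projections 𝕜 n Y) (hpq : lipSum p q < ENNReal.ofReal s)
    (hpq' : lipSum p q' < ENNReal.ofReal s) :
    JoinedIn (projectionPairs 𝕜 n X Y L) (p, q) (p, q') := by
  obtain ⟨K₁, hK₁, h₁⟩ := exists_lipschitzWith_of_lip_lt hpq
  obtain ⟨K₂, hK₂, h₂⟩ := exists_lipschitzWith_of_lip_lt hpq'
  set K := max K₁ K₂ with hK
  have hKs : (K : ℝ) < s := by rw [hK, NNReal.coe_max]; exact max_lt hK₁ hK₂
  have hKε : K * ε < 1 / 2 := by nlinarith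
  have hKL : (1 - 2 * (K * ε))⁻¹ * K < L := by
    refine lt_of_le_of_lt ?_ hL
    have : 0 < 1 - 2 * ε * s := by linarith
    exact mul_le_mul (inv_anti₀ this (by nlinarith)) hKs.le K.2 (inv_nonneg.mpr this.le)
  let H : C(Y × unitInterval, Matrix (Fin n) (Fin n) 𝕜) :=
    ⟨fun w => (1 - (w.2 : ℝ)) • q w.1 + (w.2 : ℝ) • q' w.1, by fun_prop⟩
  have hH : ∀ t : unitInterval, LipschitzWith K (Sum.elim
      (fun x => (p.comp ContinuousMap.fst : C(X × unitInterval, _)) (x, t)) (fun y => H (y, t)) :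
        X ⊕ Y → Matrix (Fin n) (Fin n) 𝕜) := fun t => by
    have e : (Sum.elim (fun x => (p.comp ContinuousMap.fst : C(X × unitInterval, _)) (x, t))
          (fun y => H (y, t)) : X ⊕ Y → Matrix (Fin n) (Fin n) 𝕜)
        = fun z => (1 - (t : ℝ)) • (Sum.elim p q : X ⊕ Y → Matrix (Fin n) (Fin n) 𝕜) z
          + (t : ℝ) • (Sum.elim p q' : X ⊕ Y → Matrix (Fin n) (Fin n) 𝕜) z := by
      funext z
      rcases z with x | y
      · change p x = (1 - (t : ℝ)) • p x + (t : ℝ) • p x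
        module
      · rfl
    rw [e]
    refine LipschitzWith.of_dist_le_mul fun z z' => ?_
    have c1 := (h₁.weaken (le_max_left K₁ K₂)).dist_le_mul z z'
    have c2 := (h₂.weaken (le_max_right K₁ K₂)).dist_le_mul z z'
    refine (dist_add_add_le _ _ _ _).trans ?_
    rw [dist_smul₀, dist_smul₀, Real.norm_of_nonneg (sub_nonneg.mpr t.2.2),
      Real.norm_of_nonneg t.2.1]
    calc _ ≤ (1 - (t : ℝ)) * (K * dist z z') + t * (K * dist z z') :=
          add_le_add (mul_le_mul_of_nonneg_left c1 (sub_nonneg.mpr t.2.2))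
            (mul_le_mul_of_nonneg_left c2 t.2.1)
      _ = K * dist z z' := by ring
  obtain ⟨Q, hQ, hj⟩ := joinedIn_projectionPairs (𝕜 := 𝕜) (n := n) hX hY hε.le hd hKε hKL
    (p.comp ContinuousMap.fst) H (fun w => hp.1 w.1)
    (fun w => ((IsSelfAdjoint.all _).smul (hq.1 w.1).isSelfAdjoint).add
      ((IsSelfAdjoint.all _).smul (hq'.1 w.1).isSelfAdjoint)) hH
  refine hj p p q q' (fun _ => rfl) (fun _ => rfl) (fun y => ?_) (fun y => ?_)
  · simp [hQ, H, specProj_eq_self (hq.1 y)]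
  · simp [hQ, H, specProj_eq_self (hq'.1 y)]

lemma compactSpace_of_isometry_inl_inr {X Y Z : Type*} [MetricSpace X] [CompactSpace X]
    [MetricSpace Y] [CompactSpace Y] [MetricSpace Z] {i : X → Z} {j : Y → Z} (hi : Isometry i)
    (hj : Isometry j) (h : ∀ z, z ∈ Set.range i ∪ Set.range j) : CompactSpace Z :=
  ⟨by
    rw [← Set.eq_univ_of_forall h]
    exact (isCompact_range hi.continuous).union (isCompact_range hj.continuous)⟩

/-- The extension property for a compact metric space that is the union of isometric images of `X`
and `Y`, with the extension restricted to `Y`. The ambient space `Z` is kept abstract because its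
metric topology is not syntactically that of a disjoint union. -/
lemma IsExtensionConst.exists_extension_of_union {c : ℝ≥0} (hc : IsExtensionConst n c)
    {X Y Z : Type*} [MetricSpace X] [CompactSpace X] [MetricSpace Y] [CompactSpace Y]
    [MetricSpace Z] {i : X → Z} {j : Y → Z} (hi : Isometry i) (hj : Isometry j)
    (h : ∀ z, z ∈ Set.range i ∪ Set.range j)
    (F : C(X × unitInterval, Matrix (Fin n) (Fin n) 𝕜)) (hF : ∀ w, IsSelfAdjoint (F w))
    {N : ℝ≥0} (hN : ∀ t, LipschitzWith N fun x => F (x, t)) :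
    ∃ H : C(Y × unitInterval, Matrix (Fin n) (Fin n) 𝕜), (∀ w, IsSelfAdjoint (H w)) ∧
      ∀ t, ∃ g : Z → Matrix (Fin n) (Fin n) 𝕜, LipschitzWith (c * N) g ∧
        (∀ x, g (i x) = F (x, t)) ∧ ∀ y, g (j y) = H (y, t) := by
  have := compactSpace_of_isometry_inl_inr hi hj h
  obtain ⟨G, h1, h2, h3⟩ := hc.exists_extension hi F hF hN
  exact ⟨⟨fun w => G (j w.1, w.2), G.continuous.comp
    ((hj.continuous.comp continuous_fst).prodMk continuous_snd)⟩, fun w => h1 _,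
    fun t => ⟨fun z => G (z, t), h3 t, fun x => h2 x t, fun y => rfl⟩⟩

/-- A path of projections on `X` with Lipschitz constant at most `r` is accompanied by a path of
projections on `Y`. -/
lemma IsExtensionConst.exists_joinedIn_projectionPairs [CompactSpace X] [CompactSpace Y]
    {c : ℝ≥0} (hc : IsExtensionConst n c)
    (hX : Isometry (Sum.inl : X → X ⊕ Y)) (hY : Isometry (Sum.inr : Y → X ⊕ Y)) {ε L : ℝ}
    {r : ℝ≥0} (hε : 0 ≤ ε)
    (hd : ∀ y : Y, ∃ x : X, dist (Sum.inr y : X ⊕ Y) (Sum.inl x) ≤ ε)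
    (hrε : c * r * ε < 1 / 2) (hL : (1 - 2 * (c * r * ε))⁻¹ * (c * r) < L)
    {p₀ p₁ : C(X, Matrix (Fin n) (Fin n) 𝕜)} (hp : JoinedIn (projectionsLT 𝕜 n X r) p₀ p₁) :
    ∃ q₀ q₁, JoinedIn (projectionPairs 𝕜 n X Y L) (p₀, q₀) (p₁, q₁) := by
  obtain ⟨γ, hγ⟩ := hp
  let F : C(X × unitInterval, Matrix (Fin n) (Fin n) 𝕜) :=
    (ContinuousMap.uncurry (γ : C(unitInterval, C(X, Matrix (Fin n) (Fin n) 𝕜)))).comp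
      ContinuousMap.prodSwap
  have hF : ∀ w, IsStarProjection (F w) := fun w => (hγ w.2).1.1 w.1
  have hN : ∀ t, LipschitzWith r fun x => F (x, t) := fun t => by
    refine lip_le_iff.mp ((hγ t).2.le.trans_eq ?_)
    rw [ENNReal.ofReal_coe_nnreal]
  obtain ⟨H, hH, hg⟩ := hc.exists_extension_of_union hX hY (fun z => by
    rcases z with x | y <;> simp) F (fun w => (hF w).isSelfAdjoint) hN
  obtain ⟨Q, -, hj⟩ := joinedIn_projectionPairs (𝕜 := 𝕜) (n := n) hX hY (K := c * r) (L := L) hε hd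
    (by push_cast; exact hrε) (by push_cast; exact hL) F H hF hH fun t => by
      obtain ⟨g, h1, h2, h3⟩ := hg t
      convert h1 using 1
      funext z
      rcases z with x | y
      · exact (h2 x).symm
      · exact (h3 y).symm
  exact ⟨Q.comp (ContinuousMap.id Y |>.prodMk (ContinuousMap.const Y 0)),
    Q.comp (ContinuousMap.id Y |>.prodMk (ContinuousMap.const Y 1)),
    hj _ _ _ _ (fun x => congrArg (fun p => p x) γ.source)
      (fun x => congrArg (fun p => p x) γ.target) (fun _ => rfl) (fun _ => rfl)⟩

end Paths
/-! ### Choice of constants and conclusion -/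

/-- The numerical content of the choice of constants: with `a = λ r`, any `K` slightly larger than
`a` satisfies `K / (1 - 2 ε K) < s`. -/
lemma exists_forall_lt_of_mul_lt {a ε s : ℝ} (ha : 0 < a) (hε : 0 < ε)
    (h : ε * a < 1 / 14) (hs : s = a * (1 - 12 * (ε * a))⁻¹) :
    0 < s ∧ ε * s < 1 / 2 ∧ ∃ b, a < b ∧ ∀ K, 0 ≤ K → K < b →
      K * ε < 1 / 2 ∧ (1 - 2 * (K * ε))⁻¹ * K < s := by
  have hεa : 0 < ε * a := by positivity
  have h12 : 0 < 1 - 12 * (ε * a) := by linarith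
  have h10 : 0 < 1 - 10 * (ε * a) := by linarith
  refine ⟨by rw [hs]; positivity, ?_, a / (1 - 10 * (ε * a)), ?_, fun K hK hKb => ?_⟩
  · rw [hs, ← mul_assoc, ← div_eq_mul_inv, div_lt_iff₀ h12]
    linarith
  · rw [lt_div_iff₀ h10]
    nlinarith
  · rw [lt_div_iff₀ h10] at hKb
    have h1 : K * ε < 1 / 4 := by
      have h2 : K * ε * (1 - 10 * (ε * a)) < ε * a := by nlinarith
      nlinarith [mul_nonneg hK hε.le]
    refine ⟨by linarith, ?_⟩
    rw [hs, inv_mul_eq_div, ← div_eq_mul_inv, div_lt_div_iff₀ (by linarith) h12]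
    nlinarith

end ProjBundle

open ProjBundle

theorem theorem6p5 {𝕜 : Type*} [RCLike 𝕜] (n : ℕ) (hn : 0 < n)
    {X Y : Type*} [MetricSpace X] [CompactSpace X] [MetricSpace Y] [CompactSpace Y]
    -- a metric on the disjoint union that restricts to the given metrics on `X` and `Y`
    [MetricSpace (X ⊕ Y)]
    (hX : Isometry (Sum.inl : X → X ⊕ Y)) (hY : Isometry (Sum.inr : Y → X ⊕ Y))
    (r ε s : ℝ) (hr : 0 < r)
    (hε : ε * ProjBundle.extensionConst n * r < 1 / 14)
    (hs : s = ProjBundle.extensionConst n * r *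
      (1 - 12 * ε * ProjBundle.extensionConst n * r)⁻¹)
    (hH : Metric.hausdorffEDist (Set.range (Sum.inl : X → X ⊕ Y))
      (Set.range (Sum.inr : Y → X ⊕ Y)) < ENNReal.ofReal ε)
    (p₀ p₁ : C(X, Matrix (Fin n) (Fin n) 𝕜))
    (hp : JoinedIn (ProjBundle.projectionsLT 𝕜 n X r) p₀ p₁) :
    ε * s < 1 / 2 ∧
    (∃ q₀ ∈ ProjBundle.projectionsLT 𝕜 n Y s, ∃ q₁ ∈ ProjBundle.projectionsLT 𝕜 n Y s,
      ProjBundle.lipSum p₀ q₀ < ENNReal.ofReal s ∧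
      ProjBundle.lipSum p₁ q₁ < ENNReal.ofReal s) ∧
    (∀ q₀ ∈ ProjBundle.projectionsLT 𝕜 n Y s, ∀ q₁ ∈ ProjBundle.projectionsLT 𝕜 n Y s,
      ProjBundle.lipSum p₀ q₀ < ENNReal.ofReal s →
      ProjBundle.lipSum p₁ q₁ < ENNReal.ofReal s →
      (∀ δ : ℝ, 2 * ε * s < δ → δ < 1 →
        ∃ (p : Path p₀ p₁) (q : Path q₀ q₁),
          (∀ t, p t ∈ ProjBundle.projections 𝕜 n X) ∧
          (∀ t, q t ∈ ProjBundle.projections 𝕜 n Y) ∧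
          ∀ t, ProjBundle.lipSum (p t) (q t) < ENNReal.ofReal ((1 - δ)⁻¹ * s)) ∧
      ProjBundle.BundleIsomorphic q₀ q₁) := by
  have hε0 : 0 < ε := ENNReal.ofReal_pos.mp (bot_le.trans_lt hH)
  have hd : ∀ y : Y, ∃ x : X, dist (Sum.inr y : X ⊕ Y) (Sum.inl x) ≤ ε := fun y => by
    rw [Metric.hausdorffEDist_comm] at hH
    obtain ⟨_, ⟨x, rfl⟩, hx⟩ :=
      Metric.exists_edist_lt_of_hausdorffEDist_lt (Set.mem_range_self y) hH
    refine ⟨x, ?_⟩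
    rw [edist_dist] at hx
    exact (ENNReal.ofReal_lt_ofReal_iff hε0).mp hx |>.le
  lift r to ℝ≥0 using hr.le
  have hl : (0 : ℝ) < extensionConst n :=
    zero_lt_one.trans_le (by exact_mod_cast one_le_extensionConst hn)
  obtain ⟨hs0, hεs, b, hab, hb⟩ := exists_forall_lt_of_mul_lt
    (a := extensionConst n * r) (s := s) (by positivity) hε0 (by rwa [← mul_assoc])
    (by rw [hs]; ring_nf)
  -- The infimum `λ` need not be an extension constant, but some constant `c` with `c r < b` is.
  obtain ⟨c, hc, hcb⟩ : ∃ c, IsExtensionConst n c ∧ (c * r : ℝ) < b := by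
    have hbr : extensionConst n < Real.toNNReal (b / r) := by
      rw [Real.lt_toNNReal_iff_coe_lt, lt_div_iff₀ hr]
      exact hab
    obtain ⟨c, hc, hlt⟩ := exists_isExtensionConst_lt hbr
    refine ⟨c, hc, ?_⟩
    rwa [Real.lt_toNNReal_iff_coe_lt, lt_div_iff₀ hr] at hlt
  obtain ⟨hcε, hcs⟩ := hb (c * r) (by positivity) hcb
  obtain ⟨q₀', q₁', hj⟩ := hc.exists_joinedIn_projectionPairs hX hY hε0.le hd hcε hcs hp
  have hYlip : ∀ {p : C(X, Matrix (Fin n) (Fin n) 𝕜)} {q : C(Y, Matrix (Fin n) (Fin n) 𝕜)},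
      lipSum p q < ENNReal.ofReal s → lip q < ENNReal.ofReal s := fun h => by
    obtain ⟨K, hK, hl⟩ := exists_lipschitzWith_of_lip_lt h
    exact lip_lt_of_lipschitzWith (by simpa using hl.comp hY.lipschitz) hK
  obtain ⟨hp₀, hq₀', h₀'⟩ := hj.source_mem
  obtain ⟨hp₁, hq₁', h₁'⟩ := hj.target_mem
  refine ⟨hεs, ⟨q₀', ⟨hq₀', hYlip h₀'⟩, q₁', ⟨hq₁', hYlip h₁'⟩, h₀', h₁'⟩, ?_⟩
  intro q₀ hq₀ q₁ hq₁ h₀ h₁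
  have hpath : ∀ δ : ℝ, 2 * ε * s < δ → δ < 1 →
        ∃ (p : Path p₀ p₁) (q : Path q₀ q₁),
          (∀ t, p t ∈ projections 𝕜 n X) ∧ (∀ t, q t ∈ projections 𝕜 n Y) ∧
          ∀ t, lipSum (p t) (q t) < ENNReal.ofReal ((1 - δ)⁻¹ * s) := by
    intro δ hδ hδ1
    have hδ0 : 0 < δ := lt_trans (by positivity) hδ
    have hL : (1 - 2 * ε * s)⁻¹ * s < (1 - δ)⁻¹ * s :=
      mul_lt_mul_of_pos_right (inv_strictAnti₀ (by linarith) (by linarith)) hs0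
    have hsL : s ≤ (1 - δ)⁻¹ * s :=
      le_mul_of_one_le_left hs0.le ((one_le_inv₀ (by linarith)).mpr (by linarith))
    have j₀ := joinedIn_projectionPairs_of_lipSum_lt hX hY hε0 hd hεs hL hp₀ hq₀.1 hq₀' h₀ h₀'
    have j₁ := joinedIn_projectionPairs_of_lipSum_lt hX hY hε0 hd hεs hL hp₁ hq₁' hq₁.1 h₁' h₁
    have j : JoinedIn (projectionPairs 𝕜 n X Y ((1 - δ)⁻¹ * s)) (p₀, q₀') (p₁, q₁') :=
      hj.mono fun w hw => ⟨hw.1, hw.2.1, hw.2.2.trans_le (ENNReal.ofReal_le_ofReal hsL)⟩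
    obtain ⟨γ, hγ⟩ := (j₀.trans j).trans j₁
    exact ⟨γ.map continuous_fst, γ.map continuous_snd, fun t => (hγ t).1, fun t => (hγ t).2.1,
      fun t => (hγ t).2.2⟩
  refine ⟨hpath, ?_⟩
  obtain ⟨-, q, -, hq, -⟩ := hpath ((2 * ε * s + 1) / 2) (by linarith) (by linarith)
  obtain ⟨u, hu⟩ := exists_unit_mul_eq_of_path q fun t =>
    ContinuousMap.ext fun y => ((hq t).1 y).isIdempotentElem.eq
  exact bundleIsomorphic_of_unit u hu
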